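/- Write $\mathbb R^+=[0,\infty)$. For a positive, continuous function $\omega$ on $\mathbb R^+$ let $L^1(\omega)$ be the space of (classes of) complex measurable functions $f$ on $\mathbb R^+$ with $\|f\|=\int_0^\infty|f|\,\omega\,dx<\infty$, and identify its dual with $L^\infty(1/\omega)$, the measurable $h$ with $\operatorname{ess\,sup}|h|/\omega<\infty$, through $\langle f,h\rangle=\int_0^\infty fh\,dx$. Let $C_0(1/\omega)\subseteq L^\infty(1/\omega)$ be the space of continuous functions $g$ on $\mathbb R^+$ for which $g/\omega$ vanishes at infinity, with norm $\sup|g|/\omega$, and identify its dual with the space $M(\omega)$ of locally finite complex Borel measures $\mu$ on $\mathbb R^+$ with $\int\omega\,d|\mu|<\infty$, through $\langle g,\mu\rangle=\int g\,d\mu$. In particular $\delta_s\in M(\omega)$ is the functional $g\mapsto g(s)$, and $L^1(\omega)\subseteq M(\omega)$, where $f$ is the functional $g\mapsto\int_0^\infty gf\,dx$. Let $\psi$ be a non-negative, measurable function on $[0,1]$ and let $\omega_1,\omega_2$ be positive, continuous functions on $\mathbb R^+$. Assume condition (C): there is a constant $C$ with $$\int_0^1\omega_2(s/t)\,\frac{\psi(t)}{t}\,dt\le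 C\,\omega_1(s)\qquad\text{for every }s\in\mathbb R^+.$$ Then $(U_\psi f)(x)=\int_0^1 f(tx)\psi(t)\,dt$ (for almost all $x$) defines a bounded operator $U_\psi:L^1(\omega_1)\to L^1(\omega_2)$, its adjoint $U_\psi^*:L^\infty(1/\omega_2)\to L^\infty(1/\omega_1)$ restricts to a bounded operator $V_\psi:C_0(1/\omega_2)\to C_0(1/\omega_1)$, and for the operator $\overline U_\psi=V_\psi^*:M(\omega_1)\to M(\omega_2)$ and every $s>0$ we have $\overline U_\psi\delta_s\in L^1(\omega_2)$ with $$(\overline U_\psi\delta_s)(x)=\frac{\psi(s/x)}{x}\ \text{ for almost all }x\ge s,\qquad (\overline U_\psi\delta_s)(x)=0\ \text{ for almost all }x<s.$$ -/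

import Mathlib

open MeasureTheory Filter Topology
open scoped NNReal ENNReal

noncomputable section

namespace HardyCesaro

/-- Lebesgue measure on the half-line `[0, ∞)`. -/
def leb : Measure ℝ≥0 := Measure.comap ((↑) : ℝ≥0 → ℝ) volume

/-- A weight: a positive, continuous function on `[0, ∞)`. -/
structure Weight where
  /-- the underlying function -/
  toFun : ℝ≥0 → ℝ≥0
  continuous_toFun : Continuous toFun
  pos : ∀ x, 0 < toFun x

instance : CoeFun Weight (fun _ => ℝ≥0 → ℝ≥0) := ⟨Weight.toFun⟩

/-- The space `L¹(ω)` of (classes of) measurable `f : [0, ∞) → ℂ` with norm `∫ |f| ω < ∞`. Since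
`ω > 0`, equality almost everywhere for `ω dx` is equality almost everywhere for `dx`. -/
abbrev L1 (ω : Weight) : Type := Lp ℂ 1 (leb.withDensity (fun x => (ω x : ℝ≥0∞)))

/-- The continuous functions `g` on `[0, ∞)` for which `g / ω` vanishes at infinity. -/
def c0Submodule (ω : Weight) : Submodule ℂ C(ℝ≥0, ℂ) where
  carrier := {g | Tendsto (fun x => g x / ((ω x : ℝ) : ℂ)) (cocompact ℝ≥0) (𝓝 0)}
  add_mem' {f g} hf hg := by
    have h := Tendsto.add hf hg
    simpa [add_div] using h
  zero_mem' := by simp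
  smul_mem' c f hf := by
    have h := Tendsto.const_mul c hf
    simpa [mul_div_assoc] using h

/-- The space `C₀(1/ω)`. -/
def C0 (ω : Weight) : Type := c0Submodule ω

namespace C0

variable {ω : Weight}

instance : AddCommGroup (C0 ω) := inferInstanceAs (AddCommGroup (c0Submodule ω))

instance : Module ℂ (C0 ω) := inferInstanceAs (Module ℂ (c0Submodule ω))

/-- The underlying continuous function. -/
def toC (g : C0 ω) : C(ℝ≥0, ℂ) := Subtype.val g

instance : CoeFun (C0 ω) (fun _ => ℝ≥0 → ℂ) := ⟨fun g => g.toC⟩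

theorem add_apply (f g : C0 ω) (x : ℝ≥0) : (f + g) x = f x + g x := rfl

theorem smul_apply (c : ℂ) (g : C0 ω) (x : ℝ≥0) : (c • g) x = c * g x := rfl

theorem weight_ne_zero (x : ℝ≥0) : ((ω x : ℝ) : ℂ) ≠ 0 := by
  have h := (ω.pos x).ne'
  exact_mod_cast h

/-- The map `g ↦ g / ω` into the continuous functions vanishing at infinity. -/
def divWeight : C0 ω →ₗ[ℂ] ZeroAtInftyContinuousMap ℝ≥0 ℂ where
  toFun g :=
    { toFun := fun x => g x / ((ω x : ℝ) : ℂ)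
      continuous_toFun := by
        have h1 : Continuous fun x => g x := g.toC.continuous
        have h2 : Continuous fun x => ((ω x : ℝ) : ℂ) :=
          Complex.continuous_ofReal.comp (NNReal.continuous_coe.comp ω.continuous_toFun)
        exact h1.div h2 weight_ne_zero
      zero_at_infty' := g.2 }
  map_add' f g := by
    ext x
    exact add_div (f x) (g x) _
  map_smul' c g := by
    ext x
    exact mul_div_assoc c (g x) _

theorem divWeight_apply (g : C0 ω) (x : ℝ≥0) : divWeight g x = g x / ((ω x : ℝ) : ℂ) := rfl

theorem divWeight_injective : Function.Injective (divWeight (ω := ω)) := by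
  intro f g h
  apply Subtype.ext
  ext x
  have hx : f x / ((ω x : ℝ) : ℂ) = g x / ((ω x : ℝ) : ℂ) := DFunLike.congr_fun h x
  exact (div_left_inj' (weight_ne_zero x)).1 hx

/-- The norm is `‖g‖ = sup |g| / ω`. -/
instance : NormedAddCommGroup (C0 ω) :=
  NormedAddCommGroup.induced (C0 ω) (ZeroAtInftyContinuousMap ℝ≥0 ℂ) divWeight
    divWeight_injective

theorem norm_divWeight (g : C0 ω) : ‖divWeight g‖ = ‖g‖ := rfl

instance : NormedSpace ℂ (C0 ω) where
  norm_smul_le c g := by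
    rw [← norm_divWeight, ← norm_divWeight, map_smul, norm_smul]

theorem norm_divWeight_apply_le (g : C0 ω) (x : ℝ≥0) : ‖divWeight g x‖ ≤ ‖g‖ :=
  (divWeight g).toBCF.norm_coe_le_norm x

theorem norm_apply_le (g : C0 ω) (x : ℝ≥0) : ‖g x‖ ≤ ω x * ‖g‖ := by
  have h := norm_divWeight_apply_le g x
  have hω : (0 : ℝ) < ω x := ω.pos x
  rw [divWeight_apply, norm_div, Complex.norm_real, Real.norm_of_nonneg hω.le,
    div_le_iff₀ hω] at h
  linarith

end C0

/-- The space `M(ω)` of locally finite complex Borel measures `μ` on `[0, ∞)` with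
`∫ ω d|μ| < ∞`, identified in the usual way with the dual space of `C₀(1/ω)`; the measure `μ` is
the functional `g ↦ ∫ g dμ`. -/
abbrev M (ω : Weight) : Type := StrongDual ℂ (C0 ω)

/-- The point mass `δ_s`, as an element of `M(ω)`. -/
def delta (ω : Weight) (s : ℝ≥0) : M ω :=
  LinearMap.mkContinuous
    { toFun := fun g => ∫ x, g x ∂(Measure.dirac s)
      map_add' := fun f g => by simp only [integral_dirac, C0.add_apply]
      map_smul' := fun c g => by
        simp only [integral_dirac, C0.smul_apply, RingHom.id_apply, smul_eq_mul] }
    (ω s) (fun g => by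
      simp only [LinearMap.coe_mk, AddHom.coe_mk, integral_dirac]
      exact g.norm_apply_le s)

theorem delta_apply (ω : Weight) (s : ℝ≥0) (g : C0 ω) : delta ω s g = g s :=
  integral_dirac _ s

section Pairing

variable {ω : Weight}

theorem integral_mul_eq (f : ℝ≥0 → ℂ) (g : C0 ω) :
    ∫ x, f x * g x ∂leb
      = ∫ x, f x * g.divWeight x ∂(leb.withDensity (fun x => (ω x : ℝ≥0∞))) := by
  rw [integral_withDensity_eq_integral_smul ω.continuous_toFun.measurable]
  refine integral_congr_ae (Eventually.of_forall fun x => ?_)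
  have h := C0.weight_ne_zero (ω := ω) x
  simp only [C0.divWeight_apply, NNReal.smul_def, Complex.real_smul]
  field_simp

theorem integrable_mul (f : L1 ω) (g : C0 ω) :
    Integrable (fun x => f x * g.divWeight x) (leb.withDensity (fun x => (ω x : ℝ≥0∞))) :=
  (L1.integrable_coeFn f).mul_bdd (c := ‖g‖)
    (ContinuousMapClass.map_continuous g.divWeight).aestronglyMeasurable
    (Eventually.of_forall g.norm_divWeight_apply_le)

/-- The bounded bilinear pairing `⟨f, g⟩ = ∫ f(x) g(x) dx` of `f ∈ L¹(ω)` and `g ∈ C₀(1/ω)`. -/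
def pairing (ω : Weight) : L1 ω →L[ℂ] C0 ω →L[ℂ] ℂ :=
  LinearMap.mkContinuous₂
    (LinearMap.mk₂ ℂ (fun (f : L1 ω) (g : C0 ω) => ∫ x, f x * g x ∂leb)
      (fun f₁ f₂ g => by
        simp only [integral_mul_eq]
        rw [← integral_add (integrable_mul f₁ g) (integrable_mul f₂ g)]
        refine integral_congr_ae ?_
        filter_upwards [Lp.coeFn_add f₁ f₂] with x hx
        rw [hx, Pi.add_apply, add_mul])
      (fun c f g => by
        simp only [integral_mul_eq]
        rw [← integral_smul]
        refine integral_congr_ae ?_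
        filter_upwards [Lp.coeFn_smul c f] with x hx
        rw [hx, Pi.smul_apply, smul_mul_assoc])
      (fun f g₁ g₂ => by
        simp only [integral_mul_eq]
        rw [← integral_add (integrable_mul f g₁) (integrable_mul f g₂)]
        refine integral_congr_ae (Eventually.of_forall fun x => ?_)
        simp only [map_add, ZeroAtInftyContinuousMap.add_apply, mul_add])
      (fun c f g => by
        simp only [integral_mul_eq]
        rw [← integral_smul]
        refine integral_congr_ae (Eventually.of_forall fun x => ?_)
        simp only [map_smul, ZeroAtInftyContinuousMap.smul_apply, mul_smul_comm]))
    1 (fun f g => by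
      simp only [LinearMap.mk₂_apply, integral_mul_eq]
      rw [one_mul, L1.norm_eq_integral_norm, ← integral_mul_const]
      refine norm_integral_le_of_norm_le ((L1.integrable_coeFn f).norm.mul_const _)
        (Eventually.of_forall fun x => ?_)
      rw [norm_mul]
      exact mul_le_mul_of_nonneg_left (g.norm_divWeight_apply_le x) (norm_nonneg _))

theorem pairing_apply (f : L1 ω) (g : C0 ω) : pairing ω f g = ∫ x, f x * g x ∂leb := rfl

end Pairing

/-- The inclusion `L¹(ω) ⊆ M(ω)`: `f` is the functional `g ↦ ∫ f(x) g(x) dx`. -/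
def L1.toM (ω : Weight) : L1 ω →L[ℂ] M ω := pairing ω

/-- The inclusion of `C₀(1/ω)` into `L^∞(1/ω)`, the latter identified with the dual space of
`L¹(ω)`: `g` is the functional `f ↦ ∫ f(x) g(x) dx`. -/
def C0.toDualL1 (ω : Weight) : C0 ω →L[ℂ] StrongDual ℂ (L1 ω) := (pairing ω).flip

/-- The adjoint `T* : F* → E*`, `φ ↦ φ ∘ T`, of a bounded operator `T : E → F`. -/
abbrev adj {E F : Type*} [NormedAddCommGroup E] [NormedSpace ℂ E] [NormedAddCommGroup F]
    [NormedSpace ℂ F] (T : E →L[ℂ] F) : StrongDual ℂ F →L[ℂ] StrongDual ℂ E :=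
  ContinuousLinearMap.precomp ℂ T

/-- Condition (C): there is a constant `C` with
`∫₀¹ ω₂(s/t) ψ(t)/t dt ≤ C ω₁(s)` for every `s ∈ [0, ∞)`. -/
def ConditionC (ψ : ℝ≥0 → ℝ≥0) (ω₁ ω₂ : Weight) : Prop :=
  ∃ C : ℝ≥0, ∀ s : ℝ≥0,
    ∫⁻ t in Set.Icc 0 1, ((ω₂ (s / t) * (ψ t / t) : ℝ≥0) : ℝ≥0∞) ∂leb ≤ C * ω₁ s

/-- The bounded operator `U : L¹(ω₁) → L¹(ω₂)` is the generalized Hardy-Cesàro operator `U_ψ`: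
`(U f)(x) = ∫₀¹ f(tx) ψ(t) dt`, with an absolutely convergent integral, for almost all `x`. -/
def IsHardyCesaro (ψ : ℝ≥0 → ℝ≥0) {ω₁ ω₂ : Weight} (U : L1 ω₁ →L[ℂ] L1 ω₂) : Prop :=
  ∀ f : L1 ω₁, ∀ᵐ x ∂leb,
    IntegrableOn (fun t => f (t * x) * ((ψ t : ℝ) : ℂ)) (Set.Icc 0 1) leb ∧
      U f x = ∫ t in Set.Icc 0 1, f (t * x) * ((ψ t : ℝ) : ℂ) ∂leb

/-- `V : C₀(1/ω₂) → C₀(1/ω₁)` is the restriction of `U* : L^∞(1/ω₂) → L^∞(1/ω₁)` to `C₀(1/ω₂)`,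
considered as a map into `C₀(1/ω₁)`. -/
def IsRestrictedAdjoint {ω₁ ω₂ : Weight} (U : L1 ω₁ →L[ℂ] L1 ω₂) (V : C0 ω₂ →L[ℂ] C0 ω₁) : Prop :=
  ∀ g : C0 ω₂, adj U (C0.toDualL1 ω₂ g) = C0.toDualL1 ω₁ (V g)

end HardyCesaro

end

noncomputable section

namespace HardyCesaro

/-! Put `dν(t) = ψ(t)/t dt` on `[0, 1]`. Then `U f(x) = ∫ f(tx) t dν(t)`, and condition (C) says `∫
ω₂(s/t) dν(t) ≤ C ω₁(s)`. Tonelli and the substitution `y = tx`, whose Jacobian is the factor `t`,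
turn this bound into `‖U‖ ≤ C` (`Admissible.lintegral_dilate`). The same computation with Fubini
identifies the restricted adjoint as `V g(s) = ∫ g(s/t) dν(t)` (`Admissible.integral_operator_mul`).

The delicate point is that `V g` is continuous and that `V g / ω₁` vanishes at infinity. Since `ν`
is finite, dominated convergence settles continuity for bounded `g`; a general `g` is approximated
by cutoffs in the norm of `C₀(1/ω₂)`. Decay follows from `s/t ≥ s`.

Finally `⟨g, V* δ_s⟩ = V g(s) = ∫ g(s/t) dν(t)`, so `V* δ_s` is the push-forward of `ν` under `t ↦
s/t`. For `s > 0` the inversion gives it the density `(s/x²) ψ(s/x)/(s/x) = ψ(s/x)/x` on `x ≥ s`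
(`toM_deltaImage`). Uniqueness of `V` and of the density rests on injectivity of the two embeddings
given by the pairing. -/

/-! ### Lebesgue measure on the half-line: dilations, inversions, test functions. -/

theorem lintegral_leb (h : ℝ → ℝ≥0∞) :
    ∫⁻ x : ℝ≥0, h x ∂leb = ∫⁻ x in Set.Ioi (0 : ℝ), h x := by
  rw [restrict_Ioi_eq_restrict_Ici]
  exact lintegral_subtype_comap measurableSet_Ici h

theorem integral_leb (h : ℝ → ℂ) :
    ∫ x : ℝ≥0, h x ∂leb = ∫ x in Set.Ici (0 : ℝ), h x :=
  integral_subtype_comap measurableSet_Ici h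

theorem lintegral_leb_toNNReal (h : ℝ≥0 → ℝ≥0∞) :
    ∫⁻ x, h x ∂leb = ∫⁻ x in Set.Ioi (0 : ℝ), h x.toNNReal := by
  simpa using lintegral_leb fun x => h x.toNNReal

theorem measurableEmbedding_coe : MeasurableEmbedding ((↑) : ℝ≥0 → ℝ) :=
  MeasurableEmbedding.subtype_coe measurableSet_Ici

theorem leb_singleton_zero : leb {0} = 0 := by
  rw [leb, measurableEmbedding_coe.comap_apply]
  simp

theorem ae_leb_pos : ∀ᵐ x ∂leb, 0 < x := by
  have : ∀ᵐ x ∂leb, x ≠ 0 := by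
    rw [ae_iff]; simpa using leb_singleton_zero
  filter_upwards [this] with x hx using pos_iff_ne_zero.2 hx

instance : IsLocallyFiniteMeasure leb := by
  refine ⟨fun x => ⟨Set.Iio (x + 1), Iio_mem_nhds (lt_add_one x), ?_⟩⟩
  rw [leb, measurableEmbedding_coe.comap_apply]
  have hsub : ((↑) : ℝ≥0 → ℝ) '' Set.Iio (x + 1) ⊆ Set.Ico 0 ((x + 1 : ℝ≥0) : ℝ) := by
    rintro _ ⟨y, hy, rfl⟩
    exact ⟨y.2, hy⟩
  refine (measure_mono hsub).trans_lt ?_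
  rw [Real.volume_Ico]
  exact ENNReal.ofReal_lt_top

instance : leb.IsOpenPosMeasure := by
  refine ⟨fun U hU ⟨x, hx⟩ h => ?_⟩
  rw [leb, measurableEmbedding_coe.comap_apply] at h
  obtain ⟨ε, hε, hb⟩ := Metric.isOpen_iff.1 hU x hx
  have hsub : Set.Ioo (x : ℝ) (x + ε) ⊆ (↑) '' U := by
    intro y hy
    have hy0 : 0 ≤ y := x.2.trans hy.1.le
    refine ⟨y.toNNReal, hb ?_, Real.coe_toNNReal y hy0⟩
    rw [Metric.mem_ball, NNReal.dist_eq, abs_lt, Real.coe_toNNReal y hy0]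
    constructor <;> linarith [hy.1, hy.2]
  have := measure_mono_null hsub h
  simp [hε.not_ge] at this

/-- The dilation `x ↦ t x` has Jacobian `t`. -/
theorem lintegral_mul_left (t : ℝ≥0) (ht : 0 < t) (h : ℝ≥0 → ℝ≥0∞) :
    ∫⁻ x, t * h (t * x) ∂leb = ∫⁻ y, h y ∂leb := by
  have ht' : (0 : ℝ) < t := ht
  have himg : (fun x : ℝ => t * x) '' Set.Ioi 0 = Set.Ioi 0 := by
    rw [Set.image_const_mul_Ioi_zero ht']
  rw [lintegral_leb_toNNReal, lintegral_leb_toNNReal h]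
  conv_rhs => rw [← himg]
  rw [
    lintegral_image_eq_lintegral_abs_deriv_mul (f' := fun _ => (t : ℝ)) measurableSet_Ioi
      (fun x _ => by simpa using ((hasDerivAt_id x).const_mul (t : ℝ)).hasDerivWithinAt)
      (mul_right_injective₀ ht'.ne').injOn]
  refine lintegral_congr fun x => ?_
  rw [abs_of_pos ht', ENNReal.ofReal_coe_nnreal, Real.toNNReal_mul ht'.le, Real.toNNReal_coe]

/-- The inversion `x ↦ s / x` has Jacobian `s / x²`. -/
theorem lintegral_const_div (s : ℝ≥0) (hs : 0 < s) (h : ℝ≥0 → ℝ≥0∞) :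
    ∫⁻ x, (s / x ^ 2 : ℝ≥0) * h (s / x) ∂leb = ∫⁻ y, h y ∂leb := by
  have hs' : (0 : ℝ) < s := hs
  have himg : (fun x : ℝ => s / x) '' Set.Ioi 0 = Set.Ioi 0 := by
    ext y
    constructor
    · rintro ⟨x, hx, rfl⟩
      exact div_pos hs' hx
    · intro hy
      exact ⟨s / y, div_pos hs' hy, div_div_cancel₀ hs'.ne'⟩
  have hinj : Set.InjOn (fun x : ℝ => s / x) (Set.Ioi 0) := by
    intro x _ y _ hxy
    have h1 : s / (s / x) = s / (s / y : ℝ) := congrArg (fun z => (s : ℝ) / z) hxy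
    rwa [div_div_cancel₀ hs'.ne', div_div_cancel₀ hs'.ne'] at h1
  rw [lintegral_leb_toNNReal, lintegral_leb_toNNReal h]
  conv_rhs => rw [← himg]
  rw [lintegral_image_eq_lintegral_abs_deriv_mul (f' := fun x => -(s : ℝ) / x ^ 2)
      measurableSet_Ioi (fun x hx => ?_) hinj]
  · refine setLIntegral_congr_fun measurableSet_Ioi fun x hx => ?_
    have hx0 : (0 : ℝ) < x := hx
    have h1 : |-(s : ℝ) / x ^ 2| = s / x ^ 2 := by
      rw [neg_div, abs_neg, abs_of_pos (by positivity)]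
    simp only [h1]
    rw [Real.toNNReal_div hs'.le, Real.toNNReal_coe]
    congr 2
    rw [Real.toNNReal_div hs'.le, Real.toNNReal_coe, Real.toNNReal_pow hx0.le]
  · have := ((hasDerivAt_inv (ne_of_gt (Set.mem_Ioi.1 hx))).const_mul (s : ℝ)).hasDerivWithinAt
      (s := Set.Ioi 0)
    simpa [div_eq_mul_inv] using this

/-- Since `ψ` is only a.e. measurable, composing with the inversion needs preimages of null sets to
be null. The Jacobian `s / x²` is positive off `0`, so this follows from `lintegral_const_div`
applied to an indicator. -/
theorem quasiMeasurePreserving_const_div (s : ℝ≥0) (hs : 0 < s) :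
    Measure.QuasiMeasurePreserving (fun x => s / x) leb leb := by
  have hm : Measurable fun x : ℝ≥0 => s / x := measurable_const.div measurable_id
  refine ⟨hm, Measure.AbsolutelyContinuous.mk fun A hA h0 => ?_⟩
  rw [Measure.map_apply hm hA, measure_eq_zero_iff_ae_notMem]
  have h := lintegral_const_div s hs (A.indicator 1)
  have hm' : Measurable fun x =>
      ((s / x ^ 2 : ℝ≥0) : ℝ≥0∞) * A.indicator (1 : ℝ≥0 → ℝ≥0∞) (s / x) :=
    (by fun_prop : Measurable fun x : ℝ≥0 => ((s / x ^ 2 : ℝ≥0) : ℝ≥0∞)).mul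
      ((measurable_one.indicator hA).comp hm)
  rw [lintegral_indicator_one hA, h0, lintegral_eq_zero_iff hm'] at h
  filter_upwards [h, ae_leb_pos] with x hx hx0 hxA
  have h1 : A.indicator (1 : ℝ≥0 → ℝ≥0∞) (s / x) = 1 := Set.indicator_of_mem (s := A) hxA _
  simp only [h1, mul_one, Pi.zero_apply, ENNReal.coe_eq_zero] at hx
  exact (div_pos hs (pow_pos hx0 2)).ne' hx

theorem measurePreserving_mul_left (t : ℝ≥0) (ht : 0 < t) :
    MeasurePreserving (fun x => t * x) (t • leb) leb := by
  refine ⟨measurable_const_mul t, ?_⟩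
  ext A hA
  have hm : Measurable fun x => A.indicator (1 : ℝ≥0 → ℝ≥0∞) (t * x) :=
    (measurable_one.indicator hA).comp (measurable_const_mul t)
  rw [Measure.map_apply (measurable_const_mul t) hA, ← lintegral_indicator_one hA,
    ← lintegral_mul_left t ht, lintegral_const_mul _ hm,
    Measure.smul_apply,
    ← lintegral_indicator_one (measurable_const_mul t hA)]
  rfl

theorem integral_mul_left (t : ℝ≥0) (ht : 0 < t) (h : ℝ≥0 → ℂ) :
    ∫ x, ((t : ℝ) : ℂ) * h (t * x) ∂leb = ∫ y, h y ∂leb := by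
  conv_rhs => rw [← (measurePreserving_mul_left t ht).integral_comp
    (measurableEmbedding_mulLeft₀ ht.ne')]
  rw [integral_smul_nnreal_measure, integral_const_mul, NNReal.smul_def, Complex.real_smul]

/-- Pushing `κ dt` forward under the inversion `t ↦ s / t`. -/
theorem map_const_div_withDensity (s : ℝ≥0) (hs : 0 < s) (κ : ℝ≥0 → ℝ≥0) :
    (leb.withDensity fun t => κ t).map (fun t => s / t)
      = leb.withDensity fun x => ((s / x ^ 2 * κ (s / x) : ℝ≥0) : ℝ≥0∞) := by
  have hm : Measurable fun x : ℝ≥0 => s / x := measurable_const.div measurable_id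
  ext A hA
  rw [Measure.map_apply hm hA, withDensity_apply _ (hm hA), withDensity_apply _ hA,
    ← lintegral_indicator (hm hA), ← lintegral_indicator hA, ← lintegral_const_div s hs]
  refine lintegral_congr fun x => ?_
  have h1 : s / (s / x) = x := div_div_cancel₀ hs.ne'
  by_cases hx : x ∈ A <;> simp [Set.indicator, h1, hx]

/-- A function that integrates to zero against all compactly supported continuous functions. -/
theorem ae_eq_zero_of_integral_mul_eq_zero {H : ℝ≥0 → ℂ} (hH : Integrable H leb)
    (h : ∀ φ : C(ℝ≥0, ℂ), HasCompactSupport φ → ∫ x, H x * φ x ∂leb = 0) :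
    H =ᵐ[leb] 0 := by
  -- Extending by zero to `ℝ` makes smooth compactly supported test functions available; their
  -- restrictions to the half-line are admissible choices of `φ`.
  let G : ℝ → ℂ := (Set.Ici 0).indicator fun x => H x.toNNReal
  have hG : Integrable G := by
    rw [integrable_indicator_iff measurableSet_Ici]
    have hr : Set.Ici (0 : ℝ) ⊆ Set.range ((↑) : ℝ≥0 → ℝ) := fun x hx =>
      ⟨x.toNNReal, Real.coe_toNNReal x hx⟩
    rw [measurableEmbedding_coe.integrableOn_iff_comap hr]
    refine Integrable.integrableOn ?_
    refine Integrable.congr (f := H) hH (Eventually.of_forall fun x => ?_)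
    exact congrArg H (Real.toNNReal_coe (r := x)).symm
  have hG0 := ae_eq_zero_of_integral_contDiff_smul_eq_zero (μ := volume) hG.locallyIntegrable
    fun g hg hgc => by
      let φ : C(ℝ≥0, ℂ) := ⟨fun x => (g x : ℂ), by
        have := hg.continuous
        fun_prop⟩
      have hφ : HasCompactSupport φ := by
        have hc : IsClosedEmbedding ((↑) : ℝ≥0 → ℝ) := isClosed_Ici.isClosedEmbedding_subtypeVal
        exact (hgc.comp_isClosedEmbedding hc).comp_left (g := ((↑) : ℝ → ℂ)) rfl
      have h2 := h φ hφ
      have h3 := integral_leb fun x => H x.toNNReal * (g x : ℂ)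
      simp only [Real.toNNReal_coe] at h3
      rw [← integral_indicator measurableSet_Ici] at h3
      rw [← h2]
      refine Eq.trans ?_ h3.symm
      refine integral_congr_ae (Eventually.of_forall fun x => ?_)
      by_cases hx : x ∈ Set.Ici (0 : ℝ) <;> simp [G, Set.indicator, hx, mul_comm]
  have h4 : ∀ᵐ x : ℝ≥0 ∂leb, G x = 0 := by
    have hq : Measure.QuasiMeasurePreserving ((↑) : ℝ≥0 → ℝ) leb volume := by
      refine ⟨measurable_subtype_coe, ?_⟩
      rw [leb, measurableEmbedding_coe.map_comap]
      exact Measure.restrict_le_self.absolutelyContinuous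
    exact hq.ae hG0
  filter_upwards [h4] with x hx
  simpa [G] using hx

/-! ### Weighted measures and the norm of `L¹(ω)`. -/

/-- The measure `ω(x) dx`. -/
abbrev Weight.measure (ω : Weight) : Measure ℝ≥0 := leb.withDensity fun x => (ω x : ℝ≥0∞)

theorem Weight.measurable (ω : Weight) : Measurable fun x => (ω x : ℝ≥0∞) :=
  ω.continuous_toFun.measurable.coe_nnreal_ennreal

theorem Weight.coe_ne_zero (ω : Weight) (x : ℝ≥0) : (ω x : ℝ≥0∞) ≠ 0 :=
  ENNReal.coe_ne_zero.2 (ω.pos x).ne'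

theorem Weight.ae_measure_iff (ω : Weight) {p : ℝ≥0 → Prop} :
    (∀ᵐ x ∂ω.measure, p x) ↔ ∀ᵐ x ∂leb, p x := by
  rw [Weight.measure, ae_withDensity_iff ω.measurable]
  exact ⟨fun h => h.mono fun x hx => hx (ω.coe_ne_zero x), fun h => h.mono fun x hx _ => hx⟩

theorem Weight.lintegral_measure (ω : Weight) (f : ℝ≥0 → ℝ≥0∞) :
    ∫⁻ x, f x ∂ω.measure = ∫⁻ x, ω x * f x ∂leb :=
  lintegral_withDensity_eq_lintegral_mul_non_measurable _ ω.measurable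
    (Eventually.of_forall fun _ => ENNReal.coe_lt_top) f

theorem enorm_coe (t : ℝ≥0) : ‖((t : ℝ) : ℂ)‖ₑ = t := by
  rw [← ofReal_norm (E := ℂ), Complex.norm_real, Real.norm_of_nonneg t.coe_nonneg,
    ENNReal.ofReal_coe_nnreal]

theorem enorm_L1 {ω : Weight} (f : L1 ω) : ‖f‖ₑ = ∫⁻ x, ω x * ‖f x‖ₑ ∂leb := by
  rw [Lp.enorm_def, eLpNorm_one_eq_lintegral_enorm, ω.lintegral_measure]

theorem L1.stronglyMeasurable_coeFn {ω : Weight} (f : L1 ω) : StronglyMeasurable f :=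
  Lp.stronglyMeasurable f

/-! ### The operator on `L¹` attached to an admissible measure. -/

/-- A measure `ν` on `(0, 1]` with `∫ ω₂(s/t) dν(t) ≤ C ω₁(s)`; the Hardy-Cesàro operator belongs
to `dν = ψ(t)/t dt`. -/
structure Admissible (ν : Measure ℝ≥0) (C : ℝ≥0) (ω₁ ω₂ : Weight) : Prop where
  ae_mem : ∀ᵐ t ∂ν, 0 < t ∧ t ≤ 1
  lintegral_le : ∀ s : ℝ≥0, ∫⁻ t, ω₂ (s / t) ∂ν ≤ C * ω₁ s

/-- The function `x ↦ ∫ f(tx) t dν(t)`. -/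
def dilate (ν : Measure ℝ≥0) (f : ℝ≥0 → ℂ) (x : ℝ≥0) : ℂ :=
  ∫ t, ((t : ℝ) : ℂ) * f (t * x) ∂ν

/-- The function `s ↦ ∫ g(s/t) dν(t)`. -/
def codilate (ν : Measure ℝ≥0) (g : ℝ≥0 → ℂ) (s : ℝ≥0) : ℂ := ∫ t, g (s / t) ∂ν

theorem measurable_const_div' (s : ℝ≥0) : Measurable fun t : ℝ≥0 => s / t :=
  measurable_const.div measurable_id

namespace Admissible

variable {ν : Measure ℝ≥0} {C : ℝ≥0} {ω₁ ω₂ : Weight}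

/-- At `s = 0` the bound reads `ω₂(0) ν(univ) ≤ C ω₁(0)`, and `ω₂(0) > 0`. -/
theorem isFiniteMeasure (hν : Admissible ν C ω₁ ω₂) : IsFiniteMeasure ν := by
  refine ⟨?_⟩
  have h := hν.lintegral_le 0
  simp only [zero_div, lintegral_const] at h
  have h2 : (ω₂ 0 : ℝ≥0∞) * ν Set.univ < ∞ :=
    h.trans_lt (ENNReal.mul_lt_top ENNReal.coe_lt_top ENNReal.coe_lt_top)
  exact ENNReal.lt_top_of_mul_ne_top_right h2.ne (ω₂.coe_ne_zero 0)

/-- Tonelli on both sides, with `y = tx` in the inner integral for `ν`-almost every `t`; the factor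
`t` is the Jacobian. -/
theorem lintegral_dilate (hν : Admissible ν C ω₁ ω₂) {f g : ℝ≥0 → ℝ≥0∞} (hf : Measurable f)
    (hg : Measurable g) :
    ∫⁻ x, ∫⁻ t, g x * (t * f (t * x)) ∂ν ∂leb = ∫⁻ y, ∫⁻ t, f y * g (y / t) ∂ν ∂leb := by
  have := hν.isFiniteMeasure
  refine (lintegral_lintegral_swap (by unfold Function.uncurry; fun_prop)).trans (Eq.trans ?_
    (lintegral_lintegral_swap (by unfold Function.uncurry; fun_prop)).symm)
  refine lintegral_congr_ae ?_
  filter_upwards [hν.ae_mem] with t ht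
  conv_rhs => rw [← lintegral_mul_left t ht.1]
  refine lintegral_congr fun x => ?_
  rw [mul_div_cancel_left₀ _ ht.1.ne']
  ring

theorem lintegral_codilate_le (hν : Admissible ν C ω₁ ω₂) {f : ℝ≥0 → ℝ≥0∞} :
    ∫⁻ y, ∫⁻ t, f y * ω₂ (y / t) ∂ν ∂leb ≤ C * ∫⁻ y, ω₁ y * f y ∂leb := by
  rw [← lintegral_const_mul' _ _ ENNReal.coe_ne_top]
  refine lintegral_mono fun y => ?_
  have hm : Measurable fun t => (ω₂ (y / t) : ℝ≥0∞) := ω₂.measurable.comp (measurable_const_div' y)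
  rw [lintegral_const_mul _ hm, ← mul_assoc, mul_comm]
  exact mul_le_mul_left (hν.lintegral_le y) _

theorem lintegral_dilate_le (hν : Admissible ν C ω₁ ω₂) (f : L1 ω₁) :
    ∫⁻ x, ∫⁻ t, ω₂ x * (t * ‖f (t * x)‖ₑ) ∂ν ∂leb ≤ C * ‖f‖ₑ := by
  rw [hν.lintegral_dilate (f := fun y => ‖f y‖ₑ) (L1.stronglyMeasurable_coeFn f).measurable.enorm
    ω₂.measurable, enorm_L1]
  exact hν.lintegral_codilate_le

theorem integrable_dilate (hν : Admissible ν C ω₁ ω₂) (f : L1 ω₁) :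
    ∀ᵐ x ∂leb, Integrable (fun t : ℝ≥0 => ((t : ℝ) : ℂ) * f (t * x)) ν := by
  have := hν.isFiniteMeasure
  have hf := (L1.stronglyMeasurable_coeFn f).measurable
  have hω := ω₂.continuous_toFun.measurable
  have h1 : ∫⁻ x, ∫⁻ t, ω₂ x * (t * ‖f (t * x)‖ₑ) ∂ν ∂leb ≠ ∞ :=
    ((hν.lintegral_dilate_le f).trans_lt (ENNReal.mul_lt_top ENNReal.coe_lt_top enorm_lt_top)).ne
  filter_upwards [ae_lt_top (by fun_prop) h1] with x hx
  refine ⟨by fun_prop, ?_⟩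
  rw [lintegral_const_mul' _ _ ENNReal.coe_ne_top] at hx
  have h2 := ENNReal.lt_top_of_mul_ne_top_right hx.ne (ω₂.coe_ne_zero x)
  refine lt_of_eq_of_lt (lintegral_congr fun t => ?_) h2
  rw [enorm_mul, enorm_coe]

theorem lintegral_enorm_dilate_le (hν : Admissible ν C ω₁ ω₂) (f : L1 ω₁) :
    eLpNorm (dilate ν f) 1 ω₂.measure ≤ C * ‖f‖ₑ := by
  rw [eLpNorm_one_eq_lintegral_enorm, ω₂.lintegral_measure]
  refine le_trans (lintegral_mono fun x => ?_) (hν.lintegral_dilate_le f)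
  rw [lintegral_const_mul' _ _ ENNReal.coe_ne_top]
  refine mul_le_mul_right ((enorm_integral_le_lintegral_enorm _).trans_eq
    (lintegral_congr fun t => ?_)) _
  rw [enorm_mul, enorm_coe]

theorem memLp_dilate (hν : Admissible ν C ω₁ ω₂) (f : L1 ω₁) :
    MemLp (dilate ν f) 1 ω₂.measure := by
  have := hν.isFiniteMeasure
  have hf := L1.stronglyMeasurable_coeFn f
  refine ⟨StronglyMeasurable.aestronglyMeasurable ?_, (hν.lintegral_enorm_dilate_le f).trans_lt
    (ENNReal.mul_lt_top ENNReal.coe_lt_top enorm_lt_top)⟩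
  have h : StronglyMeasurable fun p : ℝ≥0 × ℝ≥0 => ((p.2 : ℝ) : ℂ) * f (p.2 * p.1) := by
    have := hf.measurable
    exact Measurable.stronglyMeasurable (by fun_prop)
  exact h.integral_prod_right

/-- `dilate` acts on representatives, so linearity of the operator requires control of null sets
along `t ↦ tx`. This is `lintegral_dilate` for the indicator of a null set and `g = 1`. -/
theorem ae_ae_mul_left (hν : Admissible ν C ω₁ ω₂) {p : ℝ≥0 → Prop} (hp : ∀ᵐ y ∂leb, p y) :
    ∀ᵐ x ∂leb, ∀ᵐ t ∂ν, p (t * x) := by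
  have := hν.isFiniteMeasure
  obtain ⟨N, hpN, hN, hN0⟩ := exists_measurable_superset_of_null (ae_iff.1 hp)
  have hm : Measurable (N.indicator (1 : ℝ≥0 → ℝ≥0∞)) := measurable_one.indicator hN
  have h := hν.lintegral_dilate hm (measurable_const (a := (1 : ℝ≥0∞)))
  simp only [mul_one, lintegral_const, one_mul] at h
  rw [lintegral_mul_const _ hm, lintegral_indicator_one hN, hN0, zero_mul,
    lintegral_eq_zero_iff (by fun_prop)] at h
  filter_upwards [h] with x hx
  rw [Pi.zero_apply, lintegral_eq_zero_iff (by fun_prop)] at hx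
  filter_upwards [hx, hν.ae_mem] with t ht ht0
  by_contra hpt
  have h1 : N.indicator (1 : ℝ≥0 → ℝ≥0∞) (t * x) = 1 := Set.indicator_of_mem (s := N) (hpN hpt) _
  rw [h1, mul_one, Pi.zero_apply, ENNReal.coe_eq_zero] at ht
  exact ht0.1.ne' ht

/-- The operator `f ↦ ∫ f(t ·) t dν(t)` from `L¹(ω₁)` to `L¹(ω₂)`. -/
def operator (hν : Admissible ν C ω₁ ω₂) : L1 ω₁ →L[ℂ] L1 ω₂ :=
  LinearMap.mkContinuous
    { toFun := fun f => (hν.memLp_dilate f).toLp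
      map_add' := fun f g => by
        rw [← MemLp.toLp_add]
        refine MemLp.toLp_congr _ _ (ω₂.ae_measure_iff.2 ?_)
        filter_upwards [hν.ae_ae_mul_left (ω₁.ae_measure_iff.1 (Lp.coeFn_add f g)),
          hν.integrable_dilate f, hν.integrable_dilate g] with x hx hf hg
        rw [Pi.add_apply, dilate, dilate, dilate, ← integral_add hf hg]
        refine integral_congr_ae (hx.mono fun t ht => ?_)
        simp only [ht, Pi.add_apply, mul_add]
      map_smul' := fun c f => by
        rw [RingHom.id_apply, ← MemLp.toLp_const_smul]
        refine MemLp.toLp_congr _ _ (ω₂.ae_measure_iff.2 ?_)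
        filter_upwards [hν.ae_ae_mul_left (ω₁.ae_measure_iff.1 (Lp.coeFn_smul c f))] with x hx
        rw [Pi.smul_apply, dilate, dilate, ← integral_smul]
        refine integral_congr_ae (hx.mono fun t ht => ?_)
        simp only [ht, Pi.smul_apply, smul_eq_mul]
        ring }
    C (fun f => by
      have h : ‖(hν.memLp_dilate f).toLp‖ₑ ≤ C * ‖f‖ₑ := by
        rw [Lp.enorm_toLp]
        exact hν.lintegral_enorm_dilate_le f
      have h2 := ENNReal.toReal_mono (ENNReal.mul_lt_top ENNReal.coe_lt_top enorm_lt_top).ne h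
      rwa [ENNReal.toReal_mul, toReal_enorm, toReal_enorm, ENNReal.coe_toReal] at h2)

theorem operator_apply (hν : Admissible ν C ω₁ ω₂) (f : L1 ω₁) :
    ∀ᵐ x ∂leb, hν.operator f x = dilate ν f x :=
  ω₂.ae_measure_iff.1 (MemLp.coeFn_toLp (hν.memLp_dilate f))

/-! ### The operator on `C₀` and its duality with the operator on `L¹`. -/

theorem integrable_weight (hν : Admissible ν C ω₁ ω₂) (s : ℝ≥0) :
    Integrable (fun t => (ω₂ (s / t) : ℝ)) ν := by
  have h := (ω₂.continuous_toFun.measurable.comp (measurable_const_div' s))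
  refine ⟨by simpa using h.coe_nnreal_real.aestronglyMeasurable, ?_⟩
  refine lt_of_le_of_lt ?_
    ((hν.lintegral_le s).trans_lt (ENNReal.mul_lt_top ENNReal.coe_lt_top ENNReal.coe_lt_top))
  exact lintegral_mono fun t => by simp

theorem integral_weight_le (hν : Admissible ν C ω₁ ω₂) (s : ℝ≥0) :
    ∫ t, (ω₂ (s / t) : ℝ) ∂ν ≤ C * ω₁ s := by
  rw [integral_eq_lintegral_of_nonneg_ae (Eventually.of_forall fun t => NNReal.coe_nonneg _)
    (hν.integrable_weight s).1]
  refine ENNReal.toReal_le_of_le_ofReal (by positivity) ?_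
  simpa [ENNReal.ofReal_mul] using hν.lintegral_le s

theorem integrable_comp_div (hν : Admissible ν C ω₁ ω₂) {g : ℝ≥0 → ℂ} (hg : Continuous g)
    {K : ℝ} (hK : ∀ x, ‖g x‖ ≤ K * ω₂ x) (s : ℝ≥0) : Integrable (fun t => g (s / t)) ν :=
  ((hν.integrable_weight s).const_mul K).mono'
    (hg.measurable.comp (measurable_const_div' s)).aestronglyMeasurable
    (Eventually.of_forall fun _ => hK _)

/-- A bound on `[s, ∞)` suffices because `t ≤ 1` forces `s/t ≥ s`. This localisation yields decay at
infinity as well as the operator norm bound. -/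
theorem norm_codilate_le (hν : Admissible ν C ω₁ ω₂) {g : ℝ≥0 → ℂ} {K : ℝ} (hK0 : 0 ≤ K)
    {s : ℝ≥0} (hK : ∀ x, s ≤ x → ‖g x‖ ≤ K * ω₂ x) : ‖codilate ν g s‖ ≤ C * K * ω₁ s := by
  calc ‖codilate ν g s‖ ≤ ∫ t, K * ω₂ (s / t) ∂ν := by
        refine norm_integral_le_of_norm_le ((hν.integrable_weight s).const_mul K) ?_
        filter_upwards [hν.ae_mem] with t ht
        exact hK _ ((le_div_iff₀ ht.1).2 (mul_le_of_le_one_right' ht.2))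
    _ = K * ∫ t, (ω₂ (s / t) : ℝ) ∂ν := integral_const_mul _ _
    _ ≤ K * (C * ω₁ s) := mul_le_mul_of_nonneg_left (hν.integral_weight_le s) hK0
    _ = C * K * ω₁ s := by ring

theorem continuous_codilate_of_bounded (hν : Admissible ν C ω₁ ω₂) {g : ℝ≥0 → ℂ}
    (hg : Continuous g) {K : ℝ} (hK : ∀ x, ‖g x‖ ≤ K) : Continuous (codilate ν g) := by
  have := hν.isFiniteMeasure
  refine continuous_of_dominated (bound := fun _ => K)
    (fun s => (hg.measurable.comp (measurable_const_div' s)).aestronglyMeasurable)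
    (fun s => Eventually.of_forall fun t => hK _) (integrable_const _)
    (Eventually.of_forall fun t => ?_)
  exact hg.comp (continuous_id.div_const t)

end Admissible

theorem C0.exists_norm_le {ω : Weight} (g : C0 ω) {ε : ℝ} (hε : 0 < ε) :
    ∃ R : ℝ≥0, ∀ x, R ≤ x → ‖g x‖ ≤ ε * ω x := by
  have h : Tendsto (fun x => g x / ((ω x : ℝ) : ℂ)) (cocompact ℝ≥0) (𝓝 0) := g.2
  rw [cocompact_eq_atTop] at h
  obtain ⟨R, hR⟩ := eventually_atTop.1 (Metric.tendsto_nhds.1 h ε hε)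
  refine ⟨R, fun x hx => ?_⟩
  have h1 := (hR x hx).le
  have hω : (0 : ℝ) < ω x := ω.pos x
  rwa [dist_zero_right, norm_div, Complex.norm_real, Real.norm_of_nonneg hω.le,
    div_le_iff₀ hω] at h1

theorem C0.norm_apply_le' {ω : Weight} (g : C0 ω) (x : ℝ≥0) : ‖g x‖ ≤ ‖g‖ * ω x := by
  rw [mul_comm]
  exact g.norm_apply_le x

/-- The cutoff function that is `1` on `[0, R]` and `0` on `[R + 1, ∞)`. -/
def cutoff (R x : ℝ≥0) : ℝ≥0 := min 1 (R + 1 - x)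

theorem continuous_cutoff (R : ℝ≥0) : Continuous (cutoff R) := by
  unfold cutoff
  fun_prop

theorem cutoff_eq_one {R x : ℝ≥0} (h : x ≤ R) : cutoff R x = 1 := by
  refine min_eq_left (le_tsub_of_add_le_left ?_)
  gcongr

theorem cutoff_eq_zero {R x : ℝ≥0} (h : R + 1 ≤ x) : cutoff R x = 0 := by
  simp [cutoff, tsub_eq_zero_of_le h]

theorem cutoff_le_one (R x : ℝ≥0) : cutoff R x ≤ 1 := min_le_left _ _

theorem hasCompactSupport_cutoff_mul (R : ℝ≥0) (g : ℝ≥0 → ℂ) :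
    HasCompactSupport fun x => ((cutoff R x : ℝ) : ℂ) * g x := by
  refine HasCompactSupport.intro (isCompact_Icc (a := (0 : ℝ≥0)) (b := R + 1)) fun x hx => ?_
  have : R + 1 ≤ x := by
    by_contra h
    exact hx ⟨zero_le, (not_le.1 h).le⟩
  simp [cutoff_eq_zero this]

namespace Admissible

variable {ν : Measure ℝ≥0} {C : ℝ≥0} {ω₁ ω₂ : Weight}

/-- The hypothesis bounds each integral `∫ ω₂(s/t) dν(t)` separately and supplies no common
dominating function for nearby `s`. Instead, `codilate ν g / ω₁` is a uniform limit of the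
continuous quotients coming from cutoffs of `g`. -/
theorem continuous_codilate (hν : Admissible ν C ω₁ ω₂) (g : C0 ω₂) :
    Continuous (codilate ν g) := by
  have hgc : Continuous g := g.toC.continuous
  have hω : Continuous fun s => ((ω₁ s : ℝ) : ℂ) :=
    Complex.continuous_ofReal.comp (NNReal.continuous_coe.comp ω₁.continuous_toFun)
  suffices h : Continuous fun s => codilate ν g s / ((ω₁ s : ℝ) : ℂ) by
    refine (h.mul hω).congr fun s => ?_
    exact div_mul_cancel₀ _ (C0.weight_ne_zero s)
  refine continuous_of_uniform_approx_of_continuous fun u hu => ?_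
  obtain ⟨ε, hε, hεu⟩ := Metric.mem_uniformity_dist.1 hu
  have hC : (0 : ℝ) < C + 1 := by positivity
  -- Dividing by `C + 1` keeps the final bound `C ε / (C + 1)` strictly below `ε`, also when `C =
  -- 0`.
  obtain ⟨R, hR⟩ := g.exists_norm_le (ε := ε / (C + 1)) (by positivity)
  have hχ : Continuous fun x => ((cutoff R x : ℝ) : ℂ) :=
    Complex.continuous_ofReal.comp (NNReal.continuous_coe.comp (continuous_cutoff R))
  let k : ℝ≥0 → ℂ := fun x => ((cutoff R x : ℝ) : ℂ) * g x
  have hk : Continuous k := hχ.mul hgc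
  obtain ⟨K, hK⟩ := hk.bounded_above_of_compact_support (hasCompactSupport_cutoff_mul R g)
  refine ⟨fun s => codilate ν k s / ((ω₁ s : ℝ) : ℂ),
    (hν.continuous_codilate_of_bounded hk hK).div hω C0.weight_ne_zero, fun s => hεu ?_⟩
  have hk_le : ∀ x, ‖k x‖ ≤ ‖g‖ * ω₂ x := fun x => by
    have h1 : (cutoff R x : ℝ) ≤ 1 := cutoff_le_one R x
    calc ‖k x‖ = cutoff R x * ‖g x‖ := by simp [k]
      _ ≤ 1 * ‖g x‖ := by gcongr
      _ ≤ ‖g‖ * ω₂ x := by rw [one_mul]; exact g.norm_apply_le' x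
  have hsub : ∀ x, ‖g x - k x‖ ≤ ε / (C + 1) * ω₂ x := fun x => by
    rcases le_total x R with hx | hx
    · simp only [k, cutoff_eq_one hx, NNReal.coe_one, Complex.ofReal_one, one_mul, sub_self,
        norm_zero]
      positivity
    · have h1 : (cutoff R x : ℝ) ≤ 1 := cutoff_le_one R x
      have h2 : g x - k x = ((1 - cutoff R x : ℝ) : ℂ) * g x := by
        simp only [k]; push_cast; ring
      rw [h2, norm_mul, Complex.norm_real, Real.norm_of_nonneg (by linarith)]
      refine le_trans (mul_le_of_le_one_left (norm_nonneg _) ?_) (hR x hx)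
      linarith [(cutoff R x).coe_nonneg]
  have hω0 : (0 : ℝ) < ω₁ s := ω₁.pos s
  have h3 : codilate ν g s - codilate ν k s = codilate ν (fun x => g x - k x) s :=
    (integral_sub (hν.integrable_comp_div hgc g.norm_apply_le' s)
      (hν.integrable_comp_div hk hk_le s)).symm
  rw [dist_eq_norm, ← sub_div, h3, norm_div, Complex.norm_real, Real.norm_of_nonneg hω0.le,
    div_lt_iff₀ hω0]
  refine (hν.norm_codilate_le (by positivity) fun x _ => hsub x).trans_lt ?_
  refine mul_lt_mul_of_pos_right ?_ hω0
  rw [← mul_div_assoc, div_lt_iff₀ hC]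
  nlinarith [C.coe_nonneg]

theorem tendsto_codilate (hν : Admissible ν C ω₁ ω₂) (g : C0 ω₂) :
    Tendsto (fun s => codilate ν g s / ((ω₁ s : ℝ) : ℂ)) (cocompact ℝ≥0) (𝓝 0) := by
  rw [cocompact_eq_atTop, Metric.tendsto_nhds]
  intro ε hε
  have hC : (0 : ℝ) < C + 1 := by positivity
  obtain ⟨R, hR⟩ := g.exists_norm_le (ε := ε / (C + 1)) (by positivity)
  filter_upwards [eventually_ge_atTop R] with s hs
  have hω0 : (0 : ℝ) < ω₁ s := ω₁.pos s
  rw [dist_zero_right, norm_div, Complex.norm_real, Real.norm_of_nonneg hω0.le, div_lt_iff₀ hω0]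
  refine (hν.norm_codilate_le (by positivity) fun x hx => hR x (hs.trans hx)).trans_lt ?_
  refine mul_lt_mul_of_pos_right ?_ hω0
  rw [← mul_div_assoc, div_lt_iff₀ hC]
  nlinarith [C.coe_nonneg]

/-- The operator `g ↦ ∫ g(· / t) dν(t)` from `C₀(1/ω₂)` to `C₀(1/ω₁)`. -/
def coOperator (hν : Admissible ν C ω₁ ω₂) : C0 ω₂ →L[ℂ] C0 ω₁ :=
  LinearMap.mkContinuous
    { toFun := fun g => ⟨⟨codilate ν g, hν.continuous_codilate g⟩, hν.tendsto_codilate g⟩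
      map_add' := fun f g => by
        refine Subtype.ext (ContinuousMap.ext fun s => ?_)
        exact integral_add (hν.integrable_comp_div f.toC.continuous f.norm_apply_le' s)
          (hν.integrable_comp_div g.toC.continuous g.norm_apply_le' s)
      map_smul' := fun c g => by
        refine Subtype.ext (ContinuousMap.ext fun s => ?_)
        exact integral_const_mul c _ }
    C (fun g => by
      rw [← C0.norm_divWeight, ← ZeroAtInftyContinuousMap.norm_toBCF_eq_norm,
        BoundedContinuousFunction.norm_le (by positivity)]
      intro s
      have hω0 : (0 : ℝ) < ω₁ s := ω₁.pos s
      change ‖codilate ν g s / ((ω₁ s : ℝ) : ℂ)‖ ≤ C * ‖g‖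
      rw [norm_div, Complex.norm_real, Real.norm_of_nonneg hω0.le, div_le_iff₀ hω0]
      exact hν.norm_codilate_le (norm_nonneg g) fun x _ => g.norm_apply_le' x)

theorem coOperator_apply (hν : Admissible ν C ω₁ ω₂) (g : C0 ω₂) (s : ℝ≥0) :
    hν.coOperator g s = ∫ t, g (s / t) ∂ν := rfl

/-- Fubini with `y = tx` in between. Both double integrals converge absolutely, dominated by `‖g‖ C
‖f‖` through `|g| ≤ ‖g‖ ω₂`. -/
theorem integral_operator_mul (hν : Admissible ν C ω₁ ω₂) (f : L1 ω₁) (g : C0 ω₂) :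
    ∫ x, hν.operator f x * g x ∂leb = ∫ y, f y * hν.coOperator g y ∂leb := by
  have := hν.isFiniteMeasure
  have hf := (L1.stronglyMeasurable_coeFn f).measurable
  have hg : Measurable g := g.toC.continuous.measurable
  have hω := ω₂.measurable
  have hg_le : ∀ x, ‖g x‖ₑ ≤ ‖g‖ₑ * ω₂ x := fun x => by
    have h : ‖g x‖₊ ≤ ‖g‖₊ * ω₂ x := g.norm_apply_le' x
    change ((‖g x‖₊ : ℝ≥0) : ℝ≥0∞) ≤ (‖g‖₊ : ℝ≥0) * (ω₂ x : ℝ≥0)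
    exact_mod_cast h
  have hfin : (‖g‖ₑ : ℝ≥0∞) * (C * ‖f‖ₑ) < ∞ :=
    ENNReal.mul_lt_top enorm_lt_top (ENNReal.mul_lt_top ENNReal.coe_lt_top enorm_lt_top)
  have h1 : Integrable (Function.uncurry fun x t : ℝ≥0 => ((t : ℝ) : ℂ) * f (t * x) * g x)
      (leb.prod ν) := by
    refine ⟨Measurable.aestronglyMeasurable (by unfold Function.uncurry; fun_prop), ?_⟩
    rw [HasFiniteIntegral, lintegral_prod _ (by unfold Function.uncurry; fun_prop)]
    refine lt_of_le_of_lt ?_ hfin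
    refine le_trans ?_ (mul_le_mul_right (hν.lintegral_dilate_le f) _)
    rw [← lintegral_const_mul' _ _ enorm_ne_top]
    refine lintegral_mono fun x => ?_
    rw [← lintegral_const_mul' _ _ enorm_ne_top]
    refine lintegral_mono fun t => ?_
    simp only [Function.uncurry_apply_pair, enorm_mul, enorm_coe]
    calc _ ≤ t * ‖f (t * x)‖ₑ * (‖g‖ₑ * ω₂ x) := mul_le_mul_right (hg_le x) _
      _ = _ := by ring
  have h2 : Integrable (Function.uncurry fun y t => f y * g (y / t)) (leb.prod ν) := by
    refine ⟨Measurable.aestronglyMeasurable (by unfold Function.uncurry; fun_prop), ?_⟩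
    rw [HasFiniteIntegral, lintegral_prod _ (by unfold Function.uncurry; fun_prop)]
    refine lt_of_le_of_lt ?_ hfin
    rw [enorm_L1 f]
    refine le_trans ?_ (mul_le_mul_right (hν.lintegral_codilate_le (f := fun y => ‖f y‖ₑ)) _)
    rw [← lintegral_const_mul' _ _ enorm_ne_top]
    refine lintegral_mono fun x => ?_
    rw [← lintegral_const_mul' _ _ enorm_ne_top]
    refine lintegral_mono fun t => ?_
    simp only [Function.uncurry_apply_pair, enorm_mul]
    calc _ ≤ ‖f x‖ₑ * (‖g‖ₑ * ω₂ (x / t)) := mul_le_mul_right (hg_le _) _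
      _ = _ := by ring
  calc ∫ x, hν.operator f x * g x ∂leb
      = ∫ x, ∫ t, ((t : ℝ) : ℂ) * f (t * x) * g x ∂ν ∂leb := by
        refine integral_congr_ae ((hν.operator_apply f).mono fun x hx => ?_)
        simp only [hx, dilate, integral_mul_const]
    _ = ∫ t, ∫ x, ((t : ℝ) : ℂ) * f (t * x) * g x ∂leb ∂ν := integral_integral_swap h1
    _ = ∫ t, ∫ y, f y * g (y / t) ∂leb ∂ν := by
        refine integral_congr_ae (hν.ae_mem.mono fun t ht => ?_)
        simp only
        conv_rhs => rw [← integral_mul_left t ht.1]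
        refine integral_congr_ae (Eventually.of_forall fun x => ?_)
        simp only [mul_div_cancel_left₀ _ ht.1.ne', mul_assoc]
    _ = ∫ y, ∫ t, f y * g (y / t) ∂ν ∂leb := (integral_integral_swap h2).symm
    _ = ∫ y, f y * hν.coOperator g y ∂leb := by
        refine integral_congr_ae (Eventually.of_forall fun x => ?_)
        simp only [integral_const_mul, coOperator_apply]

end Admissible
-- Injectivity of the embeddings into dual spaces.
theorem L1.toM_injective (ω : Weight) : Function.Injective (L1.toM ω) := by
  refine (injective_iff_map_eq_zero _).2 fun F hF => ?_
  have hωm := ω.continuous_toFun.measurable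
  have hInt : Integrable (fun x => ω x • F x) leb :=
    (integrable_withDensity_iff_integrable_smul hωm).1 (L1.integrable_coeFn F)
  have h0 := ae_eq_zero_of_integral_mul_eq_zero hInt fun φ hφ => by
    have hωc : Continuous fun x => ((ω x : ℝ) : ℂ) :=
      Complex.continuous_ofReal.comp (NNReal.continuous_coe.comp ω.continuous_toFun)
    -- Testing against `ω φ` moves the weight onto `F`: the function `ω F` is integrable for `dx`
    -- and orthogonal to every `φ`.
    let g : C0 ω := ⟨⟨fun x => ((ω x : ℝ) : ℂ) * φ x, hωc.mul φ.continuous⟩, by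
      have h : (fun x => ((ω x : ℝ) : ℂ) * φ x / ((ω x : ℝ) : ℂ)) = φ := by
        ext x
        exact mul_div_cancel_left₀ _ (C0.weight_ne_zero x)
      change Tendsto (fun x => ((ω x : ℝ) : ℂ) * φ x / ((ω x : ℝ) : ℂ)) _ _
      rw [h]
      exact hφ.is_zero_at_infty⟩
    have h := DFunLike.congr_fun hF g
    change ∫ x, F x * (((ω x : ℝ) : ℂ) * φ x) ∂leb = 0 at h
    rw [← h]
    refine integral_congr_ae (Eventually.of_forall fun x => ?_)
    simp only [NNReal.smul_def, Complex.real_smul]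
    ring
  refine Lp.ext (ω.ae_measure_iff.2 ?_)
  filter_upwards [h0, ω.ae_measure_iff.1 (Lp.coeFn_zero ℂ 1 ω.measure)] with x hx hz
  rw [hz]
  exact (smul_eq_zero.1 hx).resolve_left (ω.pos x).ne'

/-- If `g(s) ≠ 0`, pair `g` with its conjugate times a cutoff equal to `1` at `s`: the result is the
integral of a continuous non-negative function that is positive at `s`. -/
theorem C0.toDualL1_injective (ω : Weight) : Function.Injective (C0.toDualL1 ω) := by
  refine (injective_iff_map_eq_zero _).2 fun g hg => ?_
  have hgc : Continuous g := g.toC.continuous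
  refine Subtype.ext (ContinuousMap.ext fun s => ?_)
  change g s = 0
  by_contra hgs
  have hωc : Continuous fun x => (ω x : ℝ) := NNReal.continuous_coe.comp ω.continuous_toFun
  have hχ : Continuous fun x => (cutoff s x : ℝ) :=
    NNReal.continuous_coe.comp (continuous_cutoff s)
  have hfc : Continuous fun x => ((cutoff s x : ℝ) : ℂ) * star (g x) := by fun_prop
  have : IsLocallyFiniteMeasure ω.measure :=
    IsLocallyFiniteMeasure.withDensity_coe ω.continuous_toFun
  have hf : MemLp (fun x => ((cutoff s x : ℝ) : ℂ) * star (g x)) 1 ω.measure :=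
    memLp_one_iff_integrable.2
      (hfc.integrable_of_hasCompactSupport (hasCompactSupport_cutoff_mul s _))
  let f : L1 ω := hf.toLp
  have h := DFunLike.congr_fun hg f
  change ∫ x, f x * g x ∂leb = 0 at h
  have h2 : ∫ x, f x * g x ∂leb = ((∫ x, cutoff s x * ‖g x‖ ^ 2 ∂leb : ℝ) : ℂ) := by
    rw [← integral_complex_ofReal]
    refine integral_congr_ae ?_
    filter_upwards [ω.ae_measure_iff.1 hf.coeFn_toLp] with x hx
    rw [show f x = _ from hx, mul_assoc, mul_comm (star (g x))]
    push_cast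
    rw [← Complex.mul_conj']
    rfl
  rw [h2, Complex.ofReal_eq_zero] at h
  refine (Continuous.integral_pos_of_hasCompactSupport_nonneg_nonzero (μ := leb) (x := s)
    (f := fun x => (cutoff s x : ℝ) * ‖g x‖ ^ 2) (by fun_prop) ?_ ?_ ?_).ne' h
  · refine HasCompactSupport.intro (isCompact_Icc (a := (0 : ℝ≥0)) (b := s + 1)) fun x hx => ?_
    have : s + 1 ≤ x := by
      by_contra h
      exact hx ⟨zero_le, (not_le.1 h).le⟩
    simp [cutoff_eq_zero this]
  · intro x
    change 0 ≤ (cutoff s x : ℝ) * ‖g x‖ ^ 2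
    positivity
  · simpa [cutoff_eq_one le_rfl] using hgs

/-! ### Specialisation to `ψ(t)/t dt`; uniqueness of the operators. -/

/-- The density `ψ(t)/t` on `[0, 1]`, extended by zero. -/
def kernel (ψ : ℝ≥0 → ℝ≥0) : ℝ≥0 → ℝ≥0 := (Set.Icc 0 1).indicator fun t => ψ t / t

/-- The measure `ψ(t)/t dt` on `[0, 1]`. -/
def kernelMeasure (ψ : ℝ≥0 → ℝ≥0) : Measure ℝ≥0 := leb.withDensity fun t => (kernel ψ t : ℝ≥0∞)

theorem aemeasurable_kernel {ψ : ℝ≥0 → ℝ≥0} (hψ : AEMeasurable ψ (leb.restrict (Set.Icc 0 1))) :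
    AEMeasurable (kernel ψ) leb :=
  (aemeasurable_indicator_iff measurableSet_Icc).2 (hψ.div aemeasurable_id)

theorem admissible_kernelMeasure {ψ : ℝ≥0 → ℝ≥0}
    (hψ : AEMeasurable ψ (leb.restrict (Set.Icc 0 1))) {C : ℝ≥0} {ω₁ ω₂ : Weight}
    (hC : ∀ s : ℝ≥0,
      ∫⁻ t in Set.Icc 0 1, ((ω₂ (s / t) * (ψ t / t) : ℝ≥0) : ℝ≥0∞) ∂leb ≤ C * ω₁ s) :
    Admissible (kernelMeasure ψ) C ω₁ ω₂ where
  ae_mem := by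
    rw [kernelMeasure, ae_withDensity_iff' (aemeasurable_kernel hψ).coe_nnreal_ennreal]
    filter_upwards [ae_leb_pos] with t ht h
    exact ⟨ht, (Set.mem_of_indicator_ne_zero (ENNReal.coe_ne_zero.1 h) : t ∈ Set.Icc 0 1).2⟩
  lintegral_le s := by
    refine le_of_eq_of_le ?_ (hC s)
    rw [kernelMeasure, lintegral_withDensity_eq_lintegral_mul_non_measurable₀ _
      (aemeasurable_kernel hψ).coe_nnreal_ennreal
      (Eventually.of_forall fun _ => ENNReal.coe_lt_top), ← lintegral_indicator measurableSet_Icc]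
    refine lintegral_congr fun t => ?_
    by_cases ht : t ∈ Set.Icc (0 : ℝ≥0) 1 <;>
      simp only [Pi.mul_apply, kernel, Set.indicator_of_mem, Set.indicator_of_notMem, ht,
        not_false_eq_true, ENNReal.coe_zero, zero_mul, ENNReal.coe_mul]
    exact mul_comm _ _

theorem isHardyCesaro_operator {ψ : ℝ≥0 → ℝ≥0}
    (hψ : AEMeasurable ψ (leb.restrict (Set.Icc 0 1))) {C : ℝ≥0} {ω₁ ω₂ : Weight}
    (hν : Admissible (kernelMeasure ψ) C ω₁ ω₂) : IsHardyCesaro ψ hν.operator := by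
  intro f
  filter_upwards [hν.operator_apply f, hν.integrable_dilate f] with x hx hi
  have hae : (fun t : ℝ≥0 => kernel ψ t • (((t : ℝ) : ℂ) * f (t * x)))
      =ᵐ[leb] (Set.Icc 0 1).indicator fun t : ℝ≥0 => f (t * x) * ((ψ t : ℝ) : ℂ) := by
    -- Cancelling `t` against `ψ(t)/t` fails at `t = 0`, where the quotient is `0` by convention.
    filter_upwards [ae_leb_pos] with t ht
    by_cases ht1 : t ∈ Set.Icc (0 : ℝ≥0) 1
    · have ht0 : ((t : ℝ) : ℂ) ≠ 0 := by exact_mod_cast ht.ne'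
      rw [kernel, Set.indicator_of_mem ht1, Set.indicator_of_mem ht1, NNReal.smul_def,
        Complex.real_smul]
      push_cast
      field_simp
    · rw [kernel, Set.indicator_of_notMem ht1, Set.indicator_of_notMem ht1, zero_smul]
  constructor
  · rw [kernelMeasure, integrable_withDensity_iff_integrable_smul₀ (aemeasurable_kernel hψ)] at hi
    exact (integrable_indicator_iff measurableSet_Icc).1 (hi.congr hae)
  · rw [hx, dilate, kernelMeasure, integral_withDensity_eq_integral_smul₀ (aemeasurable_kernel hψ),
      integral_congr_ae hae, integral_indicator measurableSet_Icc]

theorem IsHardyCesaro.unique {ψ : ℝ≥0 → ℝ≥0} {ω₁ ω₂ : Weight} {U U' : L1 ω₁ →L[ℂ] L1 ω₂}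
    (hU : IsHardyCesaro ψ U) (hU' : IsHardyCesaro ψ U') : U = U' := by
  refine ContinuousLinearMap.ext fun f => Lp.ext (ω₂.ae_measure_iff.2 ?_)
  filter_upwards [hU f, hU' f] with x h h'
  rw [h.2, h'.2]

theorem IsRestrictedAdjoint.unique {ω₁ ω₂ : Weight} {U : L1 ω₁ →L[ℂ] L1 ω₂}
    {V V' : C0 ω₂ →L[ℂ] C0 ω₁} (hV : IsRestrictedAdjoint U V) (hV' : IsRestrictedAdjoint U V') :
    V = V' :=
  ContinuousLinearMap.ext fun g => C0.toDualL1_injective ω₁ ((hV g).symm.trans (hV' g))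

theorem Admissible.isRestrictedAdjoint {ν : Measure ℝ≥0} {C : ℝ≥0} {ω₁ ω₂ : Weight}
    (hν : Admissible ν C ω₁ ω₂) : IsRestrictedAdjoint hν.operator hν.coOperator :=
  fun g => ContinuousLinearMap.ext fun f => hν.integral_operator_mul f g

/-! ### The image of a point mass. -/

/-- The density of the push-forward of `ψ(t)/t dt` under `t ↦ s / t`. -/
def deltaImage (ψ : ℝ≥0 → ℝ≥0) (s x : ℝ≥0) : ℝ≥0 := s / x ^ 2 * kernel ψ (s / x)

theorem map_kernelMeasure (ψ : ℝ≥0 → ℝ≥0) {s : ℝ≥0} (hs : 0 < s) :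
    (kernelMeasure ψ).map (fun t => s / t) = leb.withDensity fun x => (deltaImage ψ s x : ℝ≥0∞) :=
  map_const_div_withDensity s hs (kernel ψ)

theorem deltaImage_of_le (ψ : ℝ≥0 → ℝ≥0) {s x : ℝ≥0} (hs : 0 < s) (hx : s ≤ x) :
    deltaImage ψ s x = ψ (s / x) / x := by
  have hx0 : 0 < x := hs.trans_le hx
  have h : s / x ∈ Set.Icc (0 : ℝ≥0) 1 := ⟨zero_le, (div_le_one hx0).2 hx⟩
  rw [deltaImage, kernel, Set.indicator_of_mem h]
  field_simp

theorem deltaImage_of_lt (ψ : ℝ≥0 → ℝ≥0) {s x : ℝ≥0} (hx : x < s) (hx0 : 0 < x) :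
    deltaImage ψ s x = 0 := by
  have h : s / x ∉ Set.Icc (0 : ℝ≥0) 1 := fun h => ((one_lt_div hx0).2 hx).not_ge h.2
  rw [deltaImage, kernel, Set.indicator_of_notMem h, mul_zero]

theorem aemeasurable_deltaImage {ψ : ℝ≥0 → ℝ≥0} (hψ : AEMeasurable ψ (leb.restrict (Set.Icc 0 1)))
    {s : ℝ≥0} (hs : 0 < s) : AEMeasurable (deltaImage ψ s) leb :=
  (by fun_prop : Measurable fun x : ℝ≥0 => s / x ^ 2).aemeasurable.mul
    ((aemeasurable_kernel hψ).comp_quasiMeasurePreserving (quasiMeasurePreserving_const_div s hs))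

/-- By the push-forward formula the norm of the density is `∫ ω₂(s/t) dν(t)`, which condition (C)
bounds at this `s`. -/
theorem memLp_deltaImage {ψ : ℝ≥0 → ℝ≥0} (hψ : AEMeasurable ψ (leb.restrict (Set.Icc 0 1)))
    {C : ℝ≥0} {ω₁ ω₂ : Weight} (hν : Admissible (kernelMeasure ψ) C ω₁ ω₂) {s : ℝ≥0} (hs : 0 < s) :
    MemLp (fun x => ((deltaImage ψ s x : ℝ) : ℂ)) 1 ω₂.measure := by
  have hm := aemeasurable_deltaImage hψ hs
  have hac : ω₂.measure ≪ leb := withDensity_absolutelyContinuous _ _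
  refine ⟨((Complex.measurable_ofReal.comp measurable_coe_nnreal_real).comp_aemeasurable
    (hm.mono_ac hac)).aestronglyMeasurable, ?_⟩
  rw [eLpNorm_one_eq_lintegral_enorm, ω₂.lintegral_measure]
  refine lt_of_eq_of_lt ?_
    ((hν.lintegral_le s).trans_lt (ENNReal.mul_lt_top ENNReal.coe_lt_top ENNReal.coe_lt_top))
  rw [← lintegral_map ω₂.measurable (measurable_const_div' s), map_kernelMeasure ψ hs,
    lintegral_withDensity_eq_lintegral_mul₀
      hm.coe_nnreal_ennreal ω₂.measurable.aemeasurable]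
  refine lintegral_congr fun x => ?_
  rw [enorm_coe, Pi.mul_apply, mul_comm]

/-- Both functionals send `g` to `∫ g(s/t) dν(t)`: one by evaluating `V g` at `s`, the other by the
push-forward formula. -/
theorem toM_deltaImage {ψ : ℝ≥0 → ℝ≥0} (hψ : AEMeasurable ψ (leb.restrict (Set.Icc 0 1)))
    {C : ℝ≥0} {ω₁ ω₂ : Weight} (hν : Admissible (kernelMeasure ψ) C ω₁ ω₂) {s : ℝ≥0} (hs : 0 < s) :
    L1.toM ω₂ (memLp_deltaImage hψ hν hs).toLp = adj hν.coOperator (delta ω₁ s) := by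
  refine ContinuousLinearMap.ext fun g => ?_
  have hg : Continuous g := g.toC.continuous
  change ∫ x, (memLp_deltaImage hψ hν hs).toLp _ x * g x ∂leb = delta ω₁ s (hν.coOperator g)
  rw [delta_apply, hν.coOperator_apply, ← integral_map (measurable_const_div' s).aemeasurable
    hg.aestronglyMeasurable, map_kernelMeasure ψ hs]
  refine Eq.trans ?_ (integral_withDensity_eq_integral_smul₀ (aemeasurable_deltaImage hψ hs) g).symm
  refine integral_congr_ae ?_
  filter_upwards [ω₂.ae_measure_iff.1 (memLp_deltaImage hψ hν hs).coeFn_toLp] with x hx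
  rw [hx, NNReal.smul_def, Complex.real_smul]

end HardyCesaro

end

open HardyCesaro in
theorem corollary3p5 (ψ : ℝ≥0 → ℝ≥0) (hψ : AEMeasurable ψ (leb.restrict (Set.Icc 0 1)))
    (ω₁ ω₂ : Weight) (hC : ConditionC ψ ω₁ ω₂) :
    (∃! U : L1 ω₁ →L[ℂ] L1 ω₂, IsHardyCesaro ψ U) ∧
    ∀ U : L1 ω₁ →L[ℂ] L1 ω₂, IsHardyCesaro ψ U →
      (∃! V : C0 ω₂ →L[ℂ] C0 ω₁, IsRestrictedAdjoint U V) ∧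
      ∀ V : C0 ω₂ →L[ℂ] C0 ω₁, IsRestrictedAdjoint U V →
        ∀ s : ℝ≥0, 0 < s →
          (∃! F : L1 ω₂, L1.toM ω₂ F = adj V (delta ω₁ s)) ∧
          ∀ F : L1 ω₂, L1.toM ω₂ F = adj V (delta ω₁ s) →
            (∀ᵐ x ∂leb, s ≤ x → F x = ((ψ (s / x) / x : ℝ≥0) : ℝ)) ∧
            (∀ᵐ x ∂leb, x < s → F x = 0) := by
  obtain ⟨C, hC⟩ := hC
  have hν := admissible_kernelMeasure hψ hC
  have hU₀ := isHardyCesaro_operator hψ hν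
  refine ⟨⟨_, hU₀, fun U hU => hU.unique hU₀⟩, fun U hU => ?_⟩
  -- Uniqueness replaces an arbitrary `U` by the constructed operator; the same device serves for
  -- `V` and `F`.
  obtain rfl := hU.unique hU₀
  have hV₀ := hν.isRestrictedAdjoint
  refine ⟨⟨_, hV₀, fun V hV => hV.unique hV₀⟩, fun V hV s hs => ?_⟩
  obtain rfl := hV.unique hV₀
  have hF₀ := toM_deltaImage hψ hν hs
  refine ⟨⟨_, hF₀, fun F hF => L1.toM_injective ω₂ (hF.trans hF₀.symm)⟩, fun F hF => ?_⟩
  obtain rfl := L1.toM_injective ω₂ (hF.trans hF₀.symm)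
  have hF₁ := ω₂.ae_measure_iff.1 (memLp_deltaImage hψ hν hs).coeFn_toLp
  constructor
  · filter_upwards [hF₁] with x hx hsx
    rw [hx, deltaImage_of_le ψ hs hsx]
  · filter_upwards [hF₁, ae_leb_pos] with x hx hx0 hxs
    rw [hx, deltaImage_of_lt ψ hxs hx0, NNReal.coe_zero, Complex.ofReal_zero]
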